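/- Let $S$ be a closed topological surface with a cellular decomposition with finite set of edges (1-cells) $E$ and finite set of faces (2-cells) $F$; that is, $S$ is obtained from finitely many polygons, one for each $f\in F$ and each with at least one side, by gluing their sides in pairs, each pair of glued sides giving one edge. The two sides of an edge may lie on the same face. Let $\Phi:E\to(0,\frac{\pi}{2})$ be a weight. For $\phi\in(0,\frac{\pi}{2})$ and $k_1,k_2>0$, let $D_1,D_2\subset\mathbb{S}^2$ be two disks of radii $r_i=\operatorname{arccot}k_i\in(0,\frac{\pi}{2})$ (so that $\partial D_i$ has constant geodesic curvature $k_i$) such that $D_1\cap D_2$ is a bigon with interior angle $\phi$; this bigon is unique up to isometry. Let $\ell_\phi(k_1,k_2)$ be the length of its side on $\partial D_1$, and let $k_1\,\ell_\phi(k_1,k_2)$ be the total geodesic curvature of that side. A circle pattern metric on $S$ realizing $\Phi$ is given, up to isometry, by the vector $k=(k_f)_{f\in F}\in\mathbb{R}_{>0}^{F}$ of geodesic curvatures of its circles, and is identified with it. Its total geodesic curvature is the vector $L(k)\in\mathbb{R}^F$ with $$L_f(k)=\sum_{s} k_f\,\ell_{\Phi(e_s)}(k_f,k_{f_s}),$$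 where $s$ runs over the sides of the polygon $f$, $e_s$ is the edge formed by $s$, and $f_s$ is the face that contains the side glued to $s$. For $F'\subset F$ let $E_{F'}$ be the set of edges that lie on the boundary of at least one face in $F'$, and let $$\mathcal{L}_1=\Big\{L\in\mathbb{R}_{>0}^{F}\ \Big|\ \sum_{f\in F'}L_f<2\sum_{e\in E_{F'}}\Phi(e)\ \text{ for all } \emptyset\neq F'\subset F\Big\}.$$ Let $\hat L\in\mathcal{L}_1$. Then there is a unique circle pattern metric $\hat k\in\mathbb{R}_{>0}^{F}$ with total geodesic curvature $L(\hat k)=\hat L$. Moreover, for every $k(0)\in\mathbb{R}_{>0}^{F}$ the prescribed combinatorial Ricci flow $$\frac{dk_i}{dt}=-(L_i(k)-\hat L_i)\,k_i,\qquad i\in F,$$ has a solution $k(t)\in\mathbb{R}_{>0}^{F}$ with initial value $k(0)$ that exists for all $t\in[0,+\infty)$; it is unique (every solution in $\mathbb{R}_{>0}^F$ on an interval $[0,T)$ with the same initial value agrees with it there); and $k(t)\to\hat k$ as $t\to+\infty$. -/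

import Mathlib

open scoped Topology

noncomputable section

namespace CirclePattern

/-! ### Closed surfaces with a cellular decomposition -/

/-- The boundary point with parameter `s ∈ [0, 1]` on the `j`-th side of an `n`-gon. The `n`-gon is
modelled by the closed unit disk of `ℂ` with `n ≥ 1` equally spaced corners on the unit circle (so
monogons and bigons are allowed). -/
def polygonSide (n : ℕ) (j : Fin n) (s : unitInterval) : Metric.closedBall (0 : ℂ) 1 :=
  ⟨(Circle.exp (2 * Real.pi * ((j : ℝ) + (s : ℝ)) / (n : ℝ)) : ℂ), by
    rw [mem_closedBall_zero_iff, Circle.norm_coe]⟩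

/-- A finite family of polygons indexed by the set `F` of faces whose sides are matched in pairs.
`E` is the set of edges; `side (e, false)` and `side (e, true)` are the two polygon sides that are
glued to form the edge `e`. They may belong to the same polygon. All sides of all polygons occur,
each exactly once. -/
structure PolygonGluing (E F : Type*) where
  numSides : F → ℕ
  numSides_pos : ∀ f, 0 < numSides f
  side : E × Bool ≃ (f : F) × Fin (numSides f)
  /-- whether the two sides of an edge are identified with opposite directions -/
  reversed : E → Bool

namespace PolygonGluing

variable {E F : Type*} (P : PolygonGluing E F)

/-- The identifications of boundary points of the polygons. -/
inductive Glued : ((_ : F) × Metric.closedBall (0 : ℂ) 1) →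
    ((_ : F) × Metric.closedBall (0 : ℂ) 1) → Prop
  | edge (e : E) (s : unitInterval) :
      Glued
        ⟨(P.side (e, false)).1, polygonSide _ (P.side (e, false)).2 s⟩
        ⟨(P.side (e, true)).1,
          polygonSide _ (P.side (e, true)).2 (if P.reversed e then unitInterval.symm s else s)⟩

/-- The surface obtained from the disjoint union of the polygons by gluing the sides in pairs, with
the quotient topology. For finite `F` it is a closed surface, orientable or not. -/
def Surface : Type _ := Quot P.Glued

instance : TopologicalSpace P.Surface := inferInstanceAs (TopologicalSpace (Quot P.Glued))

end PolygonGluing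

/-- A cellular decomposition of `S` with edges (1-cells) `E` and faces (2-cells) `F`: a
homeomorphism of `S` with a surface glued from polygons. The open faces are the images of the
polygon interiors, the edges are the images of the open polygon sides. -/
structure CellularDecomposition (E F S : Type*) [TopologicalSpace S] extends
    PolygonGluing E F where
  homeo : toPolygonGluing.Surface ≃ₜ S

/-! ### Spherical bigons -/

/-- The point of the unit sphere at distance `r` from the north pole in the direction `ψ`. -/
def spherePoint (r ψ : ℝ) : EuclideanSpace ℝ (Fin 3) :=
  !₂[Real.sin r * Real.cos ψ, Real.sin r * Real.sin ψ, Real.cos r]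

/-- The open spherical disk of center `c` and radius `r` in the unit sphere. -/
def sphericalDisk (c : EuclideanSpace ℝ (Fin 3)) (r : ℝ) : Set (EuclideanSpace ℝ (Fin 3)) :=
  {x | x ∈ Metric.sphere (0 : EuclideanSpace ℝ (Fin 3)) 1 ∧ InnerProductGeometry.angle x c < r}

/-- The circle of spherical radius `r` about `spherePoint r 0`, parametrized by the angle `θ` at
that center. It passes through the north pole at `θ = 0`. -/
def circleParam (r θ : ℝ) : EuclideanSpace ℝ (Fin 3) :=
  Real.cos r • spherePoint r 0 +
    Real.sin r • (Real.cos θ • !₂[-Real.cos r, 0, Real.sin r] + Real.sin θ • !₂[0, 1, 0])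

/-- Two disks `D₁`, `D₂` of radii `r₁`, `r₂` are placed so that both boundary circles pass through
the north pole and the directions from there to the two centers form the angle `π - φ`; thus
`D₁ ∩ D₂` is a bigon with interior angle `φ`. `bigonSideLength φ r₁ r₂` is the length of the side of
this bigon that lies on `∂D₁`, that is, of the arc `∂D₁ ∩ D₂`. -/
def bigonSideLength (φ r₁ r₂ : ℝ) : ℝ :=
  ∫ θ in {θ | θ ∈ Set.Ioc (-Real.pi) Real.pi ∧
      circleParam r₁ θ ∈ sphericalDisk (spherePoint r₂ (Real.pi - φ)) r₂},
    ‖deriv (circleParam r₁) θ‖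

/-- The radius `r = arccot k ∈ (0, π/2]` of a spherical disk whose boundary has geodesic curvature
`k = cot r ≥ 0`. -/
def radius (k : ℝ) : ℝ := Real.pi / 2 - Real.arctan k

/-- The total geodesic curvature of the side lying on `∂D₁` of the bigon of angle `φ` formed by two
disks `D₁`, `D₂` whose boundaries have geodesic curvatures `k₁`, `k₂`. -/
def bigonSideCurvature (φ k₁ k₂ : ℝ) : ℝ :=
  bigonSideLength φ (radius k₁) (radius k₂) * k₁

/-! ### Total geodesic curvature and the prescribed flow -/

namespace PolygonGluing

variable {E F : Type*} (P : PolygonGluing E F)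

/-- The face on the side `b` of the edge `e`. -/
def faceAt (e : E) (b : Bool) : F := (P.side (e, b)).1

/-- The total geodesic curvature `L_f` of the face `f` for the circle pattern with angles `Φ` whose
circles have geodesic curvatures `k`: the sum over all sides of the polygon `f` of the total
geodesic curvature of the corresponding arc of the circle of `f`. -/
def totalCurvature (Φ : E → ℝ) (k : F → ℝ) (f : F) : ℝ :=
  ∑ j : Fin (P.numSides f),
    let h := P.side.symm ⟨f, j⟩
    bigonSideCurvature (Φ h.1) (k f) (k (P.faceAt h.1 (!h.2)))

/-- The set `E_{F'}` of edges that lie on the boundary of some face in `F'`. -/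
def edgesOf [Fintype E] (F' : Finset F) : Finset E :=
  open Classical in Finset.univ.filter fun e => ∃ f ∈ F', ∃ b, P.faceAt e b = f

/-- The set `𝓛₁` of admissible total geodesic curvatures. -/
def admissible [Fintype E] (Φ : E → ℝ) : Set (F → ℝ) :=
  {L | (∀ f, 0 < L f) ∧
    ∀ F' : Finset F, F'.Nonempty → ∑ f ∈ F', L f < 2 * ∑ e ∈ P.edgesOf F', Φ e}

/-- `k` is a circle pattern metric (given by the geodesic curvatures of its circles) whose total
geodesic curvature is `L`. -/
def HasTotalCurvature (Φ : E → ℝ) (L k : F → ℝ) : Prop :=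
  (∀ f, 0 < k f) ∧ ∀ f, P.totalCurvature Φ k f = L f

/-- `k` solves the flow `dkᵢ/dt = -(Lᵢ - L̂ᵢ) kᵢ` in the space of circle pattern metrics on the
time interval `I`, with initial value `k₀` at time `0`. -/
def IsFlowOn (Φ : E → ℝ) (Lhat k₀ : F → ℝ) (I : Set ℝ) (k : ℝ → F → ℝ) : Prop :=
  k 0 = k₀ ∧ ∀ t ∈ I, ∀ i, 0 < k t i ∧
    HasDerivWithinAt (fun s => k s i) (-(P.totalCurvature Φ (k t) i - Lhat i) * k t i) I t

end PolygonGluing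

end CirclePattern

end

namespace CirclePattern

/-! Put `u = log k` and `g u = L (exp u)`. The flow becomes `u' = -(g u - Lhat)`. No potential
function is used: everything rests on two order properties of `g` (`IsDiagonallyMonotone`). Raising
the other coordinates lowers `g u i`, and adding a positive constant to all coordinates raises it
strictly. Both are read off the closed form of a bigon side, the second because `arctan x / x` is
decreasing.

Uniqueness is a comparison at the coordinate where `u - v` is largest. Existence is a Perron
argument: a subsolution `g u ≤ L` with maximal coordinate sum is a solution. The maximum exists if
the subsolutions above a given one are bounded. They are closed under suprema, so unboundedness
would give one that is huge on a nonempty set `I` of faces and bounded elsewhere. There `∑_{f ∈ I} g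
u f` is nearly `2 ∑_{e ∈ E_I} Φ e`, against the defining inequality of `𝓛₁` (`le_sum_logCurvature`).
The asymptotics come from an angle identity for Euclidean triangles (`arctan_add_arctan_eq`).

For the flow, `g` is bounded and Lipschitz in `u`, which gives a unique global solution. A maximum
principle with an exponentially decaying barrier pushes `u` below `v + ε`, where `g v = Lhat`; the
symmetry `u ↦ -u` gives the lower bound. -/

theorem sin_cos_pos {φ : ℝ} (hφ : φ ∈ Set.Ioo 0 (Real.pi / 2)) :
    0 < Real.sin φ ∧ 0 < Real.cos φ :=
  ⟨Real.sin_pos_of_pos_of_lt_pi hφ.1 (by linarith [hφ.2, Real.pi_pos]),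
    Real.cos_pos_of_mem_Ioo ⟨by linarith [hφ.1, Real.pi_pos], hφ.2⟩⟩

/-! ### The side length of a spherical bigon -/

theorem norm_spherePoint (r ψ : ℝ) : ‖spherePoint r ψ‖ = 1 := by
  rw [EuclideanSpace.norm_eq, Real.sqrt_eq_one, Fin.sum_univ_three]
  simp only [spherePoint, Real.norm_eq_abs, sq_abs]
  simp
  nlinarith [Real.sin_sq_add_cos_sq r, Real.sin_sq_add_cos_sq ψ]

theorem circleParam_eq (r θ : ℝ) : circleParam r θ =
    !₂[Real.sin r * Real.cos r * (1 - Real.cos θ), Real.sin r * Real.sin θ,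
      Real.cos r ^ 2 + Real.sin r ^ 2 * Real.cos θ] := by
  ext i
  fin_cases i <;> simp [circleParam, spherePoint] <;> ring

theorem norm_circleParam (r θ : ℝ) : ‖circleParam r θ‖ = 1 := by
  rw [circleParam_eq, EuclideanSpace.norm_eq, Real.sqrt_eq_one, Fin.sum_univ_three]
  simp only [Real.norm_eq_abs, sq_abs]
  simp
  have h1 : Real.cos r ^ 2 = 1 - Real.sin r ^ 2 := by linarith [Real.sin_sq_add_cos_sq r]
  have h2 : Real.sin θ ^ 2 = 1 - Real.cos θ ^ 2 := by linarith [Real.sin_sq_add_cos_sq θ]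
  rw [mul_pow, mul_pow, mul_pow, h1, h2]
  ring

theorem norm_deriv_circleParam {r : ℝ} (hr : 0 ≤ Real.sin r) (θ : ℝ) :
    ‖deriv (circleParam r) θ‖ = Real.sin r := by
  have h : HasDerivAt (circleParam r)
      (Real.sin r • ((-Real.sin θ) • !₂[-Real.cos r, 0, Real.sin r] +
        Real.cos θ • !₂[0, 1, 0])) θ := by
    exact ((((Real.hasDerivAt_cos θ).smul_const _).fun_add
      ((Real.hasDerivAt_sin θ).smul_const _)).fun_const_smul _).const_add _
  rw [h.deriv, norm_smul, Real.norm_of_nonneg hr, EuclideanSpace.norm_eq]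
  convert mul_one _
  rw [Real.sqrt_eq_one, Fin.sum_univ_three]
  simp only [Real.norm_eq_abs, sq_abs]
  simp
  nlinarith [Real.sin_sq_add_cos_sq r, Real.sin_sq_add_cos_sq θ]

theorem mem_sphericalDisk_iff {x c : EuclideanSpace ℝ (Fin 3)} (hx : ‖x‖ = 1) (hc : ‖c‖ = 1)
    {r : ℝ} (hr : r ∈ Set.Icc 0 Real.pi) :
    x ∈ sphericalDisk c r ↔ Real.cos r < inner ℝ x c := by
  have h := InnerProductGeometry.cos_angle x c
  rw [hx, hc] at h
  simp only [mul_one, div_one] at h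
  rw [← h, Real.strictAntiOn_cos.lt_iff_gt hr
    ⟨InnerProductGeometry.angle_nonneg x c, InnerProductGeometry.angle_le_pi x c⟩]
  simp [sphericalDisk, hx]

/-- Both circles pass through the point `θ = 0`, so the membership function vanishes there and `sin
(θ / 2)` splits off. The remaining factor vanishes at the second intersection point. -/
theorem circleParam_mem_sphericalDisk_iff {φ r₁ r₂ : ℝ} (h₁ : 0 < Real.sin r₁)
    (hr₂ : r₂ ∈ Set.Icc 0 Real.pi) (θ : ℝ) :
    circleParam r₁ θ ∈ sphericalDisk (spherePoint r₂ (Real.pi - φ)) r₂ ↔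
      0 < Real.sin (θ / 2) * (Real.sin r₂ * Real.sin φ * Real.cos (θ / 2) -
        (Real.cos r₁ * Real.sin r₂ * Real.cos φ + Real.sin r₁ * Real.cos r₂) *
          Real.sin (θ / 2)) := by
  rw [mem_sphericalDisk_iff (norm_circleParam _ _) (norm_spherePoint _ _) hr₂, circleParam_eq,
    ← sub_pos]
  conv_rhs => rw [← mul_pos_iff_of_pos_left (show 0 < 2 * Real.sin r₁ by positivity)]
  refine iff_of_eq (congrArg _ ?_)
  rw [PiLp.inner_apply, Fin.sum_univ_three]
  obtain ⟨t, rfl⟩ : ∃ t, θ = 2 * t := ⟨θ / 2, by ring⟩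
  simp [spherePoint, Real.cos_pi_sub, Real.sin_pi_sub]
  have h1 : Real.cos r₁ ^ 2 = 1 - Real.sin r₁ ^ 2 := by linarith [Real.sin_sq_add_cos_sq r₁]
  rw [Real.sin_two_mul, Real.cos_two_mul, h1]
  have h2 : Real.cos t ^ 2 = 1 - Real.sin t ^ 2 := by linarith [Real.sin_sq_add_cos_sq t]
  rw [h2]
  ring

theorem setOf_arc_eq {A B : ℝ} (hA : 0 < A) (hB : 0 < B) :
    {θ | θ ∈ Set.Ioc (-Real.pi) Real.pi ∧
      0 < Real.sin (θ / 2) * (B * Real.cos (θ / 2) - A * Real.sin (θ / 2))} =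
    Set.Ioo 0 (2 * Real.arctan (B / A)) := by
  have hlt := Real.arctan_lt_pi_div_two (B / A)
  ext θ
  obtain ⟨t, rfl⟩ : ∃ t, θ = 2 * t := ⟨θ / 2, by ring⟩
  have ht : 2 * t / 2 = t := by ring
  simp only [Set.mem_ofPred_eq, Set.mem_Ioc, Set.mem_Ioo, ht]
  have key : t ∈ Set.Ioo (-(Real.pi / 2)) (Real.pi / 2) →
      (0 < B * Real.cos t - A * Real.sin t ↔ t < Real.arctan (B / A)) := by
    intro h
    have hc := Real.cos_pos_of_mem_Ioo h
    conv_rhs => rw [← Real.arctan_tan h.1 h.2, Real.arctan_lt_arctan_iff,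
      Real.tan_eq_sin_div_cos, div_lt_div_iff₀ hc hA]
    constructor <;> intro h <;> linarith
  constructor
  · rintro ⟨⟨h1, h2⟩, h3⟩
    -- The endpoint `θ = π` is treated apart, since `tan (θ / 2)` is useless there; the product
    -- equals `-A < 0`.
    rcases eq_or_lt_of_le h2 with h2 | h2
    · obtain rfl : t = Real.pi / 2 := by linarith
      simp at h3
      linarith
    have hm : t ∈ Set.Ioo (-(Real.pi / 2)) (Real.pi / 2) := ⟨by linarith, by linarith⟩
    have hc := Real.cos_pos_of_mem_Ioo hm
    have h0 : 0 < t := by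
      by_contra! h0
      have hs := Real.sin_nonpos_of_nonpos_of_neg_pi_le h0 (by linarith [Real.pi_pos])
      nlinarith [mul_pos hB hc, mul_nonneg hA.le (neg_nonneg.2 hs)]
    have hs := Real.sin_pos_of_pos_of_lt_pi h0 (by linarith)
    exact ⟨by linarith, by linarith [(key hm).1 (pos_of_mul_pos_right h3 hs.le)]⟩
  · rintro ⟨h1, h2⟩
    have hm : t ∈ Set.Ioo (-(Real.pi / 2)) (Real.pi / 2) := ⟨by linarith, by linarith⟩
    exact ⟨⟨by linarith, by linarith⟩,
      mul_pos (Real.sin_pos_of_pos_of_lt_pi (by linarith) (by linarith))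
        ((key hm).2 (by linarith))⟩

theorem bigonSideLength_eq {φ r₁ r₂ : ℝ} (hφ : φ ∈ Set.Ioo 0 (Real.pi / 2))
    (h₁ : r₁ ∈ Set.Ioo 0 (Real.pi / 2)) (h₂ : r₂ ∈ Set.Ioo 0 (Real.pi / 2)) :
    bigonSideLength φ r₁ r₂ = 2 * Real.sin r₁ * Real.arctan (Real.sin r₂ * Real.sin φ /
      (Real.cos r₁ * Real.sin r₂ * Real.cos φ + Real.sin r₁ * Real.cos r₂)) := by
  obtain ⟨sφ, cφ⟩ := sin_cos_pos hφ
  obtain ⟨s₁, c₁⟩ := sin_cos_pos h₁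
  obtain ⟨s₂, c₂⟩ := sin_cos_pos h₂
  have hA : 0 < Real.cos r₁ * Real.sin r₂ * Real.cos φ + Real.sin r₁ * Real.cos r₂ := by
    positivity
  have hB : 0 < Real.sin r₂ * Real.sin φ := by positivity
  rw [bigonSideLength]
  simp_rw [circleParam_mem_sphericalDisk_iff s₁
    (show r₂ ∈ Set.Icc 0 Real.pi from ⟨h₂.1.le, by linarith [h₂.2, Real.pi_pos]⟩),
    norm_deriv_circleParam s₁.le]
  rw [setOf_arc_eq hA hB, MeasureTheory.setIntegral_const, MeasureTheory.measureReal_def,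
    Real.volume_Ioo, ENNReal.toReal_ofReal, smul_eq_mul]
  · ring
  · have := Real.arctan_pos.2 (div_pos hB hA)
    linarith

/-- Closed form of `bigonSideCurvature` for positive curvatures. -/
noncomputable def sideCurvature (φ k₁ k₂ : ℝ) : ℝ :=
  2 * (k₁ / √(1 + k₁ ^ 2)) *
    Real.arctan (Real.sin φ * √(1 + k₁ ^ 2) / (k₁ * Real.cos φ + k₂))

theorem bigonSideCurvature_eq {φ k₁ k₂ : ℝ} (hφ : φ ∈ Set.Ioo 0 (Real.pi / 2))
    (h₁ : 0 < k₁) (h₂ : 0 < k₂) :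
    bigonSideCurvature φ k₁ k₂ = sideCurvature φ k₁ k₂ := by
  have hr : ∀ k : ℝ, 0 < k → radius k ∈ Set.Ioo 0 (Real.pi / 2) := fun k hk =>
    ⟨sub_pos.2 (Real.arctan_lt_pi_div_two k), sub_lt_self _ (Real.arctan_pos.2 hk)⟩
  have hc := (sin_cos_pos hφ).2
  rw [bigonSideCurvature, bigonSideLength_eq hφ (hr _ h₁) (hr _ h₂)]
  simp only [radius, Real.sin_pi_div_two_sub, Real.cos_pi_div_two_sub, Real.sin_arctan,
    Real.cos_arctan]
  have e : 1 / √(1 + k₂ ^ 2) * Real.sin φ /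
      (k₁ / √(1 + k₁ ^ 2) * (1 / √(1 + k₂ ^ 2)) * Real.cos φ +
        1 / √(1 + k₁ ^ 2) * (k₂ / √(1 + k₂ ^ 2))) =
      Real.sin φ * √(1 + k₁ ^ 2) / (k₁ * Real.cos φ + k₂) := by
    have w₁ : 0 < √(1 + k₁ ^ 2) := by positivity
    have w₂ : 0 < √(1 + k₂ ^ 2) := by positivity
    have : 0 < k₁ * Real.cos φ + k₂ := by positivity
    field_simp
  rw [e, sideCurvature]
  ring

end CirclePattern

namespace CirclePattern

/-! ### Analysis of the side curvature -/

/-- Strict concavity of `arctan` on `[0, ∞)` makes the chord slope `arctan x / x` strictly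
decreasing. -/
theorem mul_arctan_lt_mul_arctan {a b : ℝ} (ha : 0 < a) (hab : a < b) :
    a * Real.arctan b < b * Real.arctan a := by
  have hconc : StrictConcaveOn ℝ (Set.Ici 0) Real.arctan := by
    apply StrictAntiOn.strictConcaveOn_of_deriv (convex_Ici 0) Real.continuous_arctan.continuousOn
    rw [interior_Ici, Real.deriv_arctan]
    intro x hx y _ hxy
    have hx : 0 < x := hx
    have : x ^ 2 < y ^ 2 := by gcongr
    dsimp only
    gcongr
  have hb : 0 < b := ha.trans hab
  have h := hconc.2 (show (0 : ℝ) ∈ Set.Ici 0 by simp) (show b ∈ Set.Ici 0 from hb.le) hb.ne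
    (show 0 < 1 - a / b from sub_pos.2 ((div_lt_one hb).2 hab)) (show 0 < a / b by positivity)
    (by ring)
  simp only [smul_eq_mul, mul_zero, zero_add, Real.arctan_zero] at h
  rw [div_mul_cancel₀ _ hb.ne', div_mul_eq_mul_div, div_lt_iff₀ hb] at h
  linarith

theorem arctan_le_self {x : ℝ} (hx : 0 ≤ x) : Real.arctan x ≤ x := by
  conv_rhs => rw [← Real.tan_arctan x]
  exact Real.le_tan (Real.arctan_nonneg.2 hx) (Real.arctan_lt_pi_div_two x)

theorem sideCurvature_anti {φ : ℝ} (hφ : φ ∈ Set.Ioo 0 (Real.pi / 2)) {k₁ k₂ k₂' : ℝ}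
    (h₁ : 0 < k₁) (h₂ : 0 < k₂) (h : k₂ ≤ k₂') :
    sideCurvature φ k₁ k₂' ≤ sideCurvature φ k₁ k₂ := by
  obtain ⟨hs, hc⟩ := sin_cos_pos hφ
  unfold sideCurvature
  refine mul_le_mul_of_nonneg_left (Real.arctan_mono ?_) (by positivity)
  gcongr

theorem sideCurvature_lt_smul {φ : ℝ} (hφ : φ ∈ Set.Ioo 0 (Real.pi / 2)) {k₁ k₂ c : ℝ}
    (h₁ : 0 < k₁) (h₂ : 0 < k₂) (hc : 1 < c) :
    sideCurvature φ k₁ k₂ < sideCurvature φ (c * k₁) (c * k₂) := by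
  obtain ⟨hs, hcos⟩ := sin_cos_pos hφ
  have hc0 : 0 < c := by linarith
  -- The first factor is homogeneous of degree 0 in `(x, y)`. The second is `arctan z / z`, and
  -- scaling by `c > 1` makes `z` smaller.
  have key : ∀ x y : ℝ, 0 < x → 0 < y → sideCurvature φ x y =
      2 * (Real.sin φ * x / (x * Real.cos φ + y)) *
        (Real.arctan (Real.sin φ * √(1 + x ^ 2) / (x * Real.cos φ + y)) /
          (Real.sin φ * √(1 + x ^ 2) / (x * Real.cos φ + y))) := by
    intro x y hx hy
    have : 0 < √(1 + x ^ 2) := by positivity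
    have : 0 < x * Real.cos φ + y := by positivity
    unfold sideCurvature
    field_simp
  rw [key _ _ h₁ h₂, key _ _ (mul_pos hc0 h₁) (mul_pos hc0 h₂)]
  have e : Real.sin φ * (c * k₁) / (c * k₁ * Real.cos φ + c * k₂) =
      Real.sin φ * k₁ / (k₁ * Real.cos φ + k₂) := by
    rw [show Real.sin φ * (c * k₁) = c * (Real.sin φ * k₁) by ring,
      show c * k₁ * Real.cos φ + c * k₂ = c * (k₁ * Real.cos φ + k₂) by ring,
      mul_div_mul_left _ _ hc0.ne']
  rw [e]
  have hlt : Real.sin φ * √(1 + (c * k₁) ^ 2) / (c * k₁ * Real.cos φ + c * k₂) <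
      Real.sin φ * √(1 + k₁ ^ 2) / (k₁ * Real.cos φ + k₂) := by
    rw [show c * k₁ * Real.cos φ + c * k₂ = c * (k₁ * Real.cos φ + k₂) by ring,
      ← div_div]
    gcongr
    rw [div_lt_iff₀ hc0, mul_assoc]
    gcongr
    rw [Real.sqrt_lt' (by positivity), mul_pow _ c, Real.sq_sqrt (by positivity)]
    nlinarith
  have h0 : 0 < Real.sin φ * √(1 + (c * k₁) ^ 2) / (c * k₁ * Real.cos φ + c * k₂) := by
    positivity
  refine mul_lt_mul_of_pos_left ?_ (by positivity)
  rw [div_lt_div_iff₀ (h0.trans hlt) h0]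
  linarith [mul_arctan_lt_mul_arctan h0 hlt]

theorem div_sqrt_one_add_sq_le_one (k : ℝ) : k / √(1 + k ^ 2) ≤ 1 := by
  rw [div_le_one (by positivity)]
  exact Real.le_sqrt_of_sq_le (by linarith)

theorem sideCurvature_nonneg {φ : ℝ} (hφ : φ ∈ Set.Ioo 0 (Real.pi / 2)) {k₁ k₂ : ℝ}
    (h₁ : 0 < k₁) (h₂ : 0 < k₂) : 0 ≤ sideCurvature φ k₁ k₂ := by
  obtain ⟨hs, hc⟩ := sin_cos_pos hφ
  have := Real.arctan_nonneg.2
    (show 0 ≤ Real.sin φ * √(1 + k₁ ^ 2) / (k₁ * Real.cos φ + k₂) by positivity)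
  unfold sideCurvature
  positivity

theorem sideCurvature_le {φ k₁ k₂ : ℝ} (h₁ : 0 < k₁) :
    sideCurvature φ k₁ k₂ ≤ Real.pi * (k₁ / √(1 + k₁ ^ 2)) := by
  have := (Real.arctan_lt_pi_div_two
    (Real.sin φ * √(1 + k₁ ^ 2) / (k₁ * Real.cos φ + k₂))).le
  have h0 : 0 ≤ 2 * (k₁ / √(1 + k₁ ^ 2)) := by positivity
  unfold sideCurvature
  nlinarith [mul_le_mul_of_nonneg_left this h0]

theorem sideCurvature_le_pi {φ k₁ k₂ : ℝ} (h₁ : 0 < k₁) : sideCurvature φ k₁ k₂ ≤ Real.pi :=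
  (sideCurvature_le h₁).trans
    (mul_le_of_le_one_right Real.pi_pos.le (div_sqrt_one_add_sq_le_one k₁))

theorem sideCurvature_le_pi_mul {φ k₁ k₂ : ℝ} (h₁ : 0 < k₁) :
    sideCurvature φ k₁ k₂ ≤ Real.pi * k₁ := by
  refine (sideCurvature_le h₁).trans (mul_le_mul_of_nonneg_left ?_ Real.pi_pos.le)
  exact div_le_self h₁.le (Real.one_le_sqrt.2 (by nlinarith))

/-! #### Asymptotics for large curvatures -/

/-- A Euclidean triangle with sides `k₁`, `k₂` enclosing the angle `π - φ` has these two arctangents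
as its other angles. -/
theorem arctan_add_arctan_eq {φ : ℝ} (hφ : φ ∈ Set.Ioo 0 (Real.pi / 2)) {k₁ k₂ : ℝ}
    (h₁ : 0 < k₁) (h₂ : 0 < k₂) :
    Real.arctan (Real.sin φ * k₁ / (k₁ * Real.cos φ + k₂)) +
      Real.arctan (Real.sin φ * k₂ / (k₂ * Real.cos φ + k₁)) = φ := by
  obtain ⟨hs, hc⟩ := sin_cos_pos hφ
  have hD₁ : 0 < k₁ * Real.cos φ + k₂ := by positivity
  have hD₂ : 0 < k₂ * Real.cos φ + k₁ := by positivity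
  have hQ : 0 < k₁ ^ 2 + k₂ ^ 2 + 2 * k₁ * k₂ * Real.cos φ := by positivity
  have hdet : (k₁ * Real.cos φ + k₂) * (k₂ * Real.cos φ + k₁) -
      Real.sin φ * k₁ * (Real.sin φ * k₂) =
      Real.cos φ * (k₁ ^ 2 + k₂ ^ 2 + 2 * k₁ * k₂ * Real.cos φ) := by
    linear_combination (-(k₁ * k₂)) * Real.sin_sq_add_cos_sq φ
  have e : 1 - Real.sin φ * k₁ / (k₁ * Real.cos φ + k₂) *
      (Real.sin φ * k₂ / (k₂ * Real.cos φ + k₁)) =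
      Real.cos φ * (k₁ ^ 2 + k₂ ^ 2 + 2 * k₁ * k₂ * Real.cos φ) /
        ((k₁ * Real.cos φ + k₂) * (k₂ * Real.cos φ + k₁)) := by
    rw [← hdet]
    field_simp
  have hpos : 0 < 1 - Real.sin φ * k₁ / (k₁ * Real.cos φ + k₂) *
      (Real.sin φ * k₂ / (k₂ * Real.cos φ + k₁)) := by
    rw [e]
    positivity
  -- The addition formula needs the product of the tangents to be below 1, which holds because `cos
  -- φ > 0`.
  rw [Real.arctan_add (by linarith), e]
  conv_rhs => rw [← Real.arctan_tan (by linarith [hφ.1, Real.pi_pos]) hφ.2]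
  rw [Real.tan_eq_sin_div_cos]
  congr 1
  field_simp
  ring

/-- For large `k₁` the root `√(1 + k₁ ^ 2)` is close to `k₁`: it may be replaced by `k₁` inside the
arctangent, and the prefactor loses at most `1 / N`. -/
theorem two_mul_arctan_le_sideCurvature {φ : ℝ} (hφ : φ ∈ Set.Ioo 0 (Real.pi / 2))
    {k₁ k₂ N : ℝ} (hN : 1 ≤ N) (h₁ : N ≤ k₁) (h₂ : 0 < k₂) :
    2 * (1 - 1 / N) * Real.arctan (Real.sin φ * k₁ / (k₁ * Real.cos φ + k₂)) ≤
      sideCurvature φ k₁ k₂ := by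
  obtain ⟨hs, hc⟩ := sin_cos_pos hφ
  have hk₁ : 0 < k₁ := by linarith
  have hw : k₁ ≤ √(1 + k₁ ^ 2) := Real.le_sqrt_of_sq_le (by linarith)
  have h0 := Real.arctan_nonneg.2
    (show 0 ≤ Real.sin φ * k₁ / (k₁ * Real.cos φ + k₂) by positivity)
  have ha : 1 - 1 / N ≤ k₁ / √(1 + k₁ ^ 2) := by
    have hw' : √(1 + k₁ ^ 2) ≤ k₁ + 1 := Real.sqrt_le_iff.2 ⟨by positivity, by nlinarith⟩
    calc 1 - 1 / N ≤ 1 - 1 / (k₁ + 1) := by gcongr; linarith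
      _ = k₁ / (k₁ + 1) := by field_simp; ring
      _ ≤ _ := by gcongr
  unfold sideCurvature
  refine mul_le_mul (by linarith) (Real.arctan_mono ?_) h0 (by positivity)
  gcongr

theorem sideCurvature_add_ge {φ : ℝ} (hφ : φ ∈ Set.Ioo 0 (Real.pi / 2))
    {k₁ k₂ N : ℝ} (hN : 1 ≤ N) (h₁ : N ≤ k₁) (h₂ : N ≤ k₂) :
    2 * φ - Real.pi / N ≤ sideCurvature φ k₁ k₂ + sideCurvature φ k₂ k₁ := by
  have e := arctan_add_arctan_eq hφ (show 0 < k₁ by linarith) (show 0 < k₂ by linarith)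
  have l₁ := two_mul_arctan_le_sideCurvature hφ hN h₁ (show 0 < k₂ by linarith)
  have l₂ := two_mul_arctan_le_sideCurvature hφ hN h₂ (show 0 < k₁ by linarith)
  have : 2 * φ / N ≤ Real.pi / N := by gcongr; linarith [hφ.2]
  calc 2 * φ - Real.pi / N ≤ 2 * φ - 2 * φ / N := by linarith
    _ = 2 * (1 - 1 / N) * φ := by ring
    _ ≤ _ := by
      conv_lhs => rw [← e]
      linarith

/-- With `k₂` bounded and `k₁` large, the second triangle angle is at most `C / N`, so the side on
the first circle alone carries almost all of `2 * φ`. -/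
theorem sideCurvature_ge {φ : ℝ} (hφ : φ ∈ Set.Ioo 0 (Real.pi / 2))
    {k₁ k₂ N C : ℝ} (hN : 1 ≤ N) (h₁ : N ≤ k₁) (h₂ : 0 < k₂) (hC : k₂ ≤ C) :
    2 * φ - (Real.pi + 2 * C) / N ≤ sideCurvature φ k₁ k₂ := by
  obtain ⟨hs, hc⟩ := sin_cos_pos hφ
  have hk₁ : 0 < k₁ := by linarith
  have hN0 : 0 < N := by linarith
  have e := arctan_add_arctan_eq hφ hk₁ h₂
  have l₁ := two_mul_arctan_le_sideCurvature hφ hN h₁ h₂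
  have hb : Real.arctan (Real.sin φ * k₂ / (k₂ * Real.cos φ + k₁)) ≤ C / N := by
    refine (arctan_le_self (by positivity)).trans ?_
    have : Real.sin φ * k₂ ≤ C := by nlinarith [Real.sin_le_one φ]
    have : N ≤ k₂ * Real.cos φ + k₁ := by nlinarith [mul_pos h₂ hc]
    have : 0 ≤ C := by linarith
    gcongr
  have hN1 : 0 ≤ 1 - 1 / N := by
    rw [sub_nonneg, div_le_one hN0]
    exact hN
  have hCN : 0 ≤ C / N := div_nonneg (by linarith) hN0.le
  have : 2 * φ / N ≤ Real.pi / N := by gcongr; linarith [hφ.2]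
  have e2 : 2 * (1 - 1 / N) * φ = 2 * φ - 2 * φ / N := by ring
  have e3 : (Real.pi + 2 * C) / N = Real.pi / N + 2 * (C / N) := by ring
  have h4 : (1 - 1 / N) * (C / N) ≤ C / N :=
    mul_le_of_le_one_left hCN (by linarith [show 0 < 1 / N by positivity])
  have h5 := mul_le_mul_of_nonneg_left
    (show φ - C / N ≤ Real.arctan (Real.sin φ * k₁ / (k₁ * Real.cos φ + k₂)) by linarith) hN1
  nlinarith

/-! #### Lipschitz bounds in logarithmic coordinates -/

theorem abs_sub_le_of_abs_deriv_le {f f' : ℝ → ℝ} (hf : ∀ x, HasDerivAt f (f' x) x)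
    (hb : ∀ x, |f' x| ≤ 1) (x y : ℝ) : |f x - f y| ≤ |x - y| := by
  have := convex_univ.norm_image_sub_le_of_norm_hasDerivWithin_le (C := 1) (f := f) (f' := f')
    (fun x _ => (hf x).hasDerivWithinAt) (fun x _ => hb x) (Set.mem_univ y) (Set.mem_univ x)
  simpa using this

theorem abs_exp_div_sqrt_sub_le (x y : ℝ) :
    |Real.exp x / √(1 + Real.exp x ^ 2) - Real.exp y / √(1 + Real.exp y ^ 2)| ≤ |x - y| := by
  refine abs_sub_le_of_abs_deriv_le (f := fun x => Real.exp x / √(1 + Real.exp x ^ 2))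
    (f' := fun x => Real.cos (Real.arctan (Real.exp x)) *
      (1 / (1 + Real.exp x ^ 2) * Real.exp x)) (fun x => ?_) (fun x => ?_) x y
  -- The function is `sin (arctan (exp x))`, which avoids differentiating the root.
  · simp_rw [← Real.sin_arctan]
    exact (Real.hasDerivAt_exp x).arctan.sin
  · rw [abs_mul]
    refine mul_le_one₀ (Real.abs_cos_le_one _) (abs_nonneg _) ?_
    rw [abs_of_pos (by positivity), one_div_mul_eq_div, div_le_one (by positivity)]
    nlinarith [sq_nonneg (Real.exp x - 1), Real.exp_pos x]

theorem abs_arctan_sub_le_left {φ : ℝ} (hφ : φ ∈ Set.Ioo 0 (Real.pi / 2)) {k : ℝ} (hk : 0 < k)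
    (x y : ℝ) :
    |Real.arctan (Real.sin φ * √(1 + Real.exp x ^ 2) / (Real.exp x * Real.cos φ + k)) -
      Real.arctan (Real.sin φ * √(1 + Real.exp y ^ 2) / (Real.exp y * Real.cos φ + k))| ≤
      |x - y| := by
  obtain ⟨hs, hc⟩ := sin_cos_pos hφ
  have hsc := Real.sin_sq_add_cos_sq φ
  refine abs_sub_le_of_abs_deriv_le (f := fun x =>
    Real.arctan (Real.sin φ * √(1 + Real.exp x ^ 2) / (Real.exp x * Real.cos φ + k)))
    (f' := fun x => Real.sin φ * Real.exp x * (Real.exp x * k - Real.cos φ) /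
      (√(1 + Real.exp x ^ 2) * (Real.exp x ^ 2 + k ^ 2 + 2 * Real.exp x * k * Real.cos φ +
        Real.sin φ ^ 2)))
    (fun x => ?_) (fun x => ?_) x y
  · have hD : 0 < Real.exp x * Real.cos φ + k := by positivity
    have hw0 : 0 < √(1 + Real.exp x ^ 2) := by positivity
    have hw : √(1 + Real.exp x ^ 2) ^ 2 = 1 + Real.exp x ^ 2 := Real.sq_sqrt (by positivity)
    have h1 := (((Real.hasDerivAt_exp x).fun_pow 2).const_add 1).sqrt (by positivity)
    have h2 := ((h1.const_mul (Real.sin φ)).div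
      (((Real.hasDerivAt_exp x).mul_const (Real.cos φ)).add_const k) hD.ne').arctan
    refine h2.congr_deriv ?_
    have hQ : 0 < Real.exp x ^ 2 + k ^ 2 + 2 * Real.exp x * k * Real.cos φ +
        Real.sin φ ^ 2 := by positivity
    have hQ' : (Real.exp x * Real.cos φ + k) ^ 2 +
        Real.sin φ ^ 2 * √(1 + Real.exp x ^ 2) ^ 2 =
        Real.exp x ^ 2 + k ^ 2 + 2 * Real.exp x * k * Real.cos φ + Real.sin φ ^ 2 := by
      rw [hw]
      linear_combination Real.exp x ^ 2 * hsc
    rw [← hQ'] at hQ ⊢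
    simp only [Pi.div_apply]
    field_simp
    rw [hw]
    push_cast
    ring
  · have hK := Real.exp_pos x
    generalize Real.exp x = K at *
    have hw0 : 1 ≤ √(1 + K ^ 2) := Real.one_le_sqrt.2 (by nlinarith)
    have hwK : K ≤ √(1 + K ^ 2) := Real.le_sqrt_of_sq_le (by linarith)
    have hQ : 0 < √(1 + K ^ 2) *
        (K ^ 2 + k ^ 2 + 2 * K * k * Real.cos φ + Real.sin φ ^ 2) := by positivity
    rw [abs_div, abs_of_pos hQ, div_le_one hQ]
    have hs1 := Real.sin_le_one φ
    have hc1 := Real.cos_le_one φ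
    -- The numerator is a difference of two positive terms, so it suffices that each is at most the
    -- denominator.
    have b1 : Real.sin φ * K * (K * k) ≤ √(1 + K ^ 2) * (K ^ 2 + k ^ 2 + 2 * K * k * Real.cos φ +
        Real.sin φ ^ 2) := by
      calc Real.sin φ * K * (K * k) ≤ 1 * √(1 + K ^ 2) * (K * k) := by gcongr
        _ = √(1 + K ^ 2) * (K * k) := by ring
        _ ≤ _ := by
          gcongr
          nlinarith [sq_nonneg (K - k), mul_pos (mul_pos hK hk) hc]
    have b2 : Real.sin φ * K * Real.cos φ ≤
        √(1 + K ^ 2) * (K ^ 2 + k ^ 2 + 2 * K * k * Real.cos φ + Real.sin φ ^ 2) := by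
      calc Real.sin φ * K * Real.cos φ ≤ Real.sin φ * K * 1 := by gcongr
        _ = 1 * (Real.sin φ * K) := by ring
        _ ≤ _ := by
          gcongr
          nlinarith [sq_nonneg (K - Real.sin φ), mul_pos (mul_pos hK hk) hc, mul_pos hs hK]
    have p1 : 0 < Real.sin φ * K * (K * k) := by positivity
    have p2 : 0 < Real.sin φ * K * Real.cos φ := by positivity
    rw [mul_sub, abs_le]
    constructor <;> linarith

theorem abs_arctan_sub_le_right {φ : ℝ} (hφ : φ ∈ Set.Ioo 0 (Real.pi / 2)) {k : ℝ} (hk : 0 < k)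
    (x y : ℝ) :
    |Real.arctan (Real.sin φ * √(1 + k ^ 2) / (k * Real.cos φ + Real.exp x)) -
      Real.arctan (Real.sin φ * √(1 + k ^ 2) / (k * Real.cos φ + Real.exp y))| ≤ |x - y| := by
  obtain ⟨hs, hc⟩ := sin_cos_pos hφ
  have hw0 : 0 < √(1 + k ^ 2) := by positivity
  refine abs_sub_le_of_abs_deriv_le (f := fun x =>
    Real.arctan (Real.sin φ * √(1 + k ^ 2) / (k * Real.cos φ + Real.exp x)))
    (f' := fun x => -(Real.sin φ * √(1 + k ^ 2) * Real.exp x) /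
      ((k * Real.cos φ + Real.exp x) ^ 2 + (Real.sin φ * √(1 + k ^ 2)) ^ 2))
    (fun x => ?_) (fun x => ?_) x y
  · have hD : 0 < k * Real.cos φ + Real.exp x := by positivity
    refine (((hasDerivAt_const x (Real.sin φ * √(1 + k ^ 2))).div
      ((Real.hasDerivAt_exp x).const_add _) hD.ne').arctan).congr_deriv ?_
    simp only [Pi.div_apply]
    field_simp
    ring
  · have hK := Real.exp_pos x
    rw [abs_div, div_le_one (by positivity), abs_neg, abs_of_pos (by positivity),
      abs_of_pos (by positivity)]
    have hm : 0 < Real.sin φ * √(1 + k ^ 2) := by positivity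
    have hkc : 0 < k * Real.cos φ := by positivity
    nlinarith [sq_nonneg (Real.sin φ * √(1 + k ^ 2) - Real.exp x), mul_pos hm hK,
      mul_pos hkc hK, sq_nonneg (k * Real.cos φ)]

theorem abs_sideCurvature_exp_sub_le {φ : ℝ} (hφ : φ ∈ Set.Ioo 0 (Real.pi / 2))
    (x y x' y' : ℝ) :
    |sideCurvature φ (Real.exp x) (Real.exp y) - sideCurvature φ (Real.exp x') (Real.exp y')| ≤
      6 * |x - x'| + 2 * |y - y'| := by
  have h1 := abs_exp_div_sqrt_sub_le x x'
  have h2 := abs_arctan_sub_le_left hφ (Real.exp_pos y) x x'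
  have h3 := abs_arctan_sub_le_right hφ (Real.exp_pos x') y y'
  unfold sideCurvature
  have ha := div_sqrt_one_add_sq_le_one (Real.exp x)
  have ha0 : 0 ≤ Real.exp x / √(1 + Real.exp x ^ 2) := by positivity
  generalize Real.exp x / √(1 + Real.exp x ^ 2) = a at *
  generalize Real.exp x' / √(1 + Real.exp x' ^ 2) = a' at *
  have hA : |Real.arctan (Real.sin φ * √(1 + Real.exp x' ^ 2) /
      (Real.exp x' * Real.cos φ + Real.exp y'))| ≤ 2 := by
    have := Real.pi_le_four
    rw [abs_le]
    constructor
    · linarith [Real.neg_pi_div_two_lt_arctan (Real.sin φ * √(1 + Real.exp x' ^ 2) /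
        (Real.exp x' * Real.cos φ + Real.exp y'))]
    · linarith [Real.arctan_lt_pi_div_two (Real.sin φ * √(1 + Real.exp x' ^ 2) /
        (Real.exp x' * Real.cos φ + Real.exp y'))]
  generalize Real.arctan (Real.sin φ * √(1 + Real.exp x ^ 2) /
      (Real.exp x * Real.cos φ + Real.exp y)) = A at *
  generalize Real.arctan (Real.sin φ * √(1 + Real.exp x' ^ 2) /
      (Real.exp x' * Real.cos φ + Real.exp y)) = B at *
  generalize Real.arctan (Real.sin φ * √(1 + Real.exp x' ^ 2) /
      (Real.exp x' * Real.cos φ + Real.exp y')) = A' at *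
  -- `B` is the intermediate value with only the first variable changed.
  have hAA : |A - A'| ≤ |x - x'| + |y - y'| := by
    calc |A - A'| ≤ |A - B| + |B - A'| := abs_sub_le _ _ _
      _ ≤ _ := add_le_add h2 h3
  calc |2 * a * A - 2 * a' * A'| = |2 * a * (A - A') + 2 * (a - a') * A'| := by ring_nf
    _ ≤ |2 * a * (A - A')| + |2 * (a - a') * A'| := abs_add_le _ _
    _ = 2 * (a * |A - A'|) + 2 * (|a - a'| * |A'|) := by
      rw [abs_mul, abs_mul, abs_mul, abs_mul, abs_of_nonneg ha0, abs_two]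
      ring
    _ ≤ 2 * (1 * (|x - x'| + |y - y'|)) + 2 * (|x - x'| * 2) := by gcongr
    _ = _ := by ring

end CirclePattern

/-! ### Bounded Lipschitz vector fields -/

namespace LipschitzWith

variable {V : Type*} [NormedAddCommGroup V] [NormedSpace ℝ V]

theorem eqOn_Ico_of_hasDerivWithinAt {K : NNReal} {v : V → V} (hv : LipschitzWith K v) {T : ℝ}
    {x y : ℝ → V} (hx : ∀ t ∈ Set.Ico 0 T, HasDerivWithinAt x (v (x t)) (Set.Ico 0 T) t)
    (hy : ∀ t ∈ Set.Ico 0 T, HasDerivWithinAt y (v (y t)) (Set.Ico 0 T) t) (h0 : x 0 = y 0) :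
    Set.EqOn x y (Set.Ico 0 T) := by
  intro t ht
  have hsub : Set.Icc 0 t ⊆ Set.Ico 0 T := fun s hs => ⟨hs.1, hs.2.trans_lt ht.2⟩
  have hder : ∀ z : ℝ → V,
      (∀ s ∈ Set.Ico 0 T, HasDerivWithinAt z (v (z s)) (Set.Ico 0 T) s) →
      ∀ s ∈ Set.Ico 0 t, HasDerivWithinAt z (v (z s)) (Set.Ici s) s := by
    intro z hz s hs
    refine (hz s (hsub ⟨hs.1, hs.2.le⟩)).mono_of_mem_nhdsWithin ?_
    filter_upwards [Ico_mem_nhdsGE (hs.2.trans ht.2)] with r hr using ⟨hs.1.trans hr.1, hr.2⟩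
  exact ODE_solution_unique_of_mem_Icc_right (v := fun _ => v) (s := fun _ => Set.univ) (K := K)
    (fun _ _ => hv.lipschitzOnWith)
    (fun s hs => ((hx s (hsub hs)).continuousWithinAt).mono hsub) (hder x hx)
    (fun _ _ => Set.mem_univ _)
    (fun s hs => ((hy s (hsub hs)).continuousWithinAt).mono hsub) (hder y hy)
    (fun _ _ => Set.mem_univ _) h0 ⟨ht.1, le_rfl⟩

theorem exists_hasDerivWithinAt_Ici [CompleteSpace V] {K : NNReal} {v : V → V}
    (hv : LipschitzWith K v) {B : NNReal} (hB : ∀ x, ‖v x‖ ≤ B) (x₀ : V) :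
    ∃ x : ℝ → V, x 0 = x₀ ∧
      ∀ t ∈ Set.Ici (0 : ℝ), HasDerivWithinAt x (v (x t)) (Set.Ici 0) t := by
  have hloc : ∀ n : ℕ, ∃ x : ℝ → V, x 0 = x₀ ∧
      ∀ t ∈ Set.Icc (0 : ℝ) n, HasDerivWithinAt x (v (x t)) (Set.Icc 0 n) t := by
    intro n
    -- A solution of speed at most `B` stays within `B * n` of `x₀` up to time `n`, so this radius
    -- imposes no restriction on the time.
    have hpl : IsPicardLindelof (fun _ => v)
        (⟨0, le_rfl, Nat.cast_nonneg n⟩ : Set.Icc (0 : ℝ) n) x₀ (B * n) 0 B K :=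
      { lipschitzOnWith := fun _ _ => hv.lipschitzOnWith
        continuousOn := fun _ _ => continuousOn_const
        norm_le := fun _ _ x _ => hB x
        mul_max_le := by simp }
    exact hpl.exists_eq_forall_mem_Icc_hasDerivWithinAt₀
  choose x hx0 hx using hloc
  have hagree : ∀ m n : ℕ, m ≤ n → Set.EqOn (x m) (x n) (Set.Ico 0 m) := by
    intro m n hmn
    have hmn' : (m : ℝ) ≤ n := by exact_mod_cast hmn
    refine hv.eqOn_Ico_of_hasDerivWithinAt (fun t ht => ?_) (fun t ht => ?_)
      ((hx0 m).trans (hx0 n).symm)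
    · exact (hx m t ⟨ht.1, ht.2.le⟩).mono Set.Ico_subset_Icc_self
    · exact (hx n t ⟨ht.1, ht.2.le.trans hmn'⟩).mono
        (Set.Ico_subset_Icc_self.trans (Set.Icc_subset_Icc_right hmn'))
  -- The `+ 1` keeps `t` strictly below the right end of its interval, as the derivative within `[0,
  -- ∞)` requires.
  refine ⟨fun t => x (⌊t⌋₊ + 1) t, hx0 _, fun t ht => ?_⟩
  have ht : 0 ≤ t := ht
  have hlt : t < (⌊t⌋₊ + 1 : ℕ) := by exact_mod_cast Nat.lt_floor_add_one t
  have hmem : Set.Ico (0 : ℝ) (⌊t⌋₊ + 1 : ℕ) ∈ 𝓝[Set.Ici 0] t := by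
    rw [← Set.Ici_inter_Iio]
    exact Filter.inter_mem self_mem_nhdsWithin (mem_nhdsWithin_of_mem_nhds (Iio_mem_nhds hlt))
  have hd := (hx (⌊t⌋₊ + 1) t ⟨ht, hlt.le⟩).mono_of_mem_nhdsWithin
    (Filter.mem_of_superset hmem Set.Ico_subset_Icc_self)
  refine hd.congr_of_eventuallyEq ?_ rfl
  filter_upwards [hmem] with s hs
  have hs2 : ⌊s⌋₊ + 1 ≤ ⌊t⌋₊ + 1 := by
    have : ⌊s⌋₊ < ⌊t⌋₊ + 1 := (Nat.floor_lt hs.1).2 (by exact_mod_cast hs.2)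
    omega
  exact hagree _ _ hs2 ⟨hs.1, by exact_mod_cast Nat.lt_floor_add_one s⟩

end LipschitzWith

/-! ### A maximum principle -/

namespace CirclePattern

theorem eventually_lt_of_hasDerivWithinAt_neg {f : ℝ → ℝ} {f' t : ℝ}
    (hf : HasDerivWithinAt f f' (Set.Ioi t) t) (hf' : f' < 0) : ∀ᶠ s in 𝓝[>] t, f s < f t := by
  rw [hasDerivWithinAt_iff_tendsto_slope' (by simp)] at hf
  filter_upwards [hf.eventually_lt_const hf', self_mem_nhdsWithin] with s hs hst
  have hst : t < s := hst
  rw [slope_def_field, div_neg_iff] at hs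
  rcases hs with hs | hs <;> linarith [hs.1, hs.2]

/-- If, whenever a coordinate of `y` touches the barrier `b` from below, it moves slower than `b`,
then `y` stays below `b`. -/
theorem le_barrier {ι : Type*} [Finite ι] {y y' : ℝ → ι → ℝ} {b b' : ℝ → ℝ}
    (hy : ∀ t, 0 ≤ t → ∀ i, HasDerivWithinAt (fun s => y s i) (y' t i) (Set.Ici 0) t)
    (hb : ∀ t, HasDerivAt b (b' t) t) (h0 : ∀ i, y 0 i ≤ b 0)
    (hlt : ∀ t, 0 ≤ t → (∀ j, y t j ≤ b t) → ∀ i, y t i = b t → y' t i < b' t)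
    {t : ℝ} (ht : 0 ≤ t) (i : ι) : y t i ≤ b t := by
  have hd : ∀ s, 0 ≤ s → ∀ j, HasDerivWithinAt (fun r => y r j - b r) (y' s j - b' s)
      (Set.Ici 0) s := fun s hs j => (hy s hs j).fun_sub (hb s).hasDerivWithinAt
  have hclosed : IsClosed ({s | ∀ j, y s j - b s ≤ 0} ∩ Set.Icc 0 t) := by
    have : {s | ∀ j, y s j - b s ≤ 0} ∩ Set.Icc 0 t =
        Set.Icc 0 t ∩ ⋂ j, (Set.Icc 0 t ∩ (fun r => y r j - b r) ⁻¹' Set.Iic 0) := by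
      ext s
      simp only [Set.mem_inter_iff, Set.mem_ofPred_eq, Set.mem_iInter, Set.mem_preimage,
        Set.mem_Iic]
      exact ⟨fun h => ⟨h.2, fun j => ⟨h.2, h.1 j⟩⟩, fun h => ⟨fun j => (h.2 j).2, h.1⟩⟩
    rw [this]
    refine isClosed_Icc.inter (isClosed_iInter fun j => ?_)
    refine ContinuousOn.preimage_isClosed_of_isClosed (fun s hs => ?_) isClosed_Icc isClosed_Iic
    exact (hd s hs.1 j).continuousWithinAt.mono Set.Icc_subset_Ici_self
  -- Continuous induction: the bound persists just after `s`, by the sign of the derivative at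
  -- touching coordinates and by continuity at the others.
  have hsub := hclosed.Icc_subset_of_forall_mem_nhdsWithin (fun j => sub_nonpos.2 (h0 j)) ?_
  · exact sub_nonpos.1 (hsub ⟨ht, le_rfl⟩ i)
  rintro s ⟨hs, hst⟩
  have hle : ∀ j, y s j ≤ b s := fun j => sub_nonpos.1 (hs j)
  have hIoi : Set.Ioi s ⊆ Set.Ici 0 := fun r hr => hst.1.trans (le_of_lt hr)
  refine Filter.eventually_all.2 fun j => ?_
  have hdj := (hd s hst.1 j).mono hIoi
  rcases (hle j).eq_or_lt with heq | hlt'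
  · filter_upwards [eventually_lt_of_hasDerivWithinAt_neg hdj
      (sub_neg.2 (hlt s hst.1 hle j heq))] with r hr
    exact hr.le.trans (hs j)
  · filter_upwards [hdj.continuousWithinAt.eventually_lt_const (sub_neg.2 hlt')] with r hr
    exact hr.le

/-- An off-diagonally antitone map which is strictly increasing along the diagonal. -/
structure IsDiagonallyMonotone {ι : Type*} (g : (ι → ℝ) → ι → ℝ) : Prop where
  anti : ∀ u v : ι → ℝ, u ≤ v → ∀ i, u i = v i → g v i ≤ g u i
  lt_add : ∀ (u : ι → ℝ) (s : ℝ), 0 < s → ∀ i, g u i < g (fun j => u j + s) i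

/-! ### Comparison, convergence and existence for diagonally monotone maps -/

namespace IsDiagonallyMonotone

variable {ι : Type*} {g : (ι → ℝ) → ι → ℝ}

theorem neg_comp_neg (hg : IsDiagonallyMonotone g) :
    IsDiagonallyMonotone fun u i => -g (fun j => -u j) i where
  anti u v huv i hi := neg_le_neg <|
    hg.anti (fun j => -v j) (fun j => -u j) (fun j => neg_le_neg (huv j)) i
      (congrArg Neg.neg hi.symm)
  lt_add u s hs i := by
    have := hg.lt_add (fun j => -(u j + s)) s hs i
    simp only [neg_add_rev, neg_add_cancel_comm] at this ⊢
    exact neg_lt_neg this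

/-- If the largest difference `u i - v i` were positive, translating `v` by it would give a vector
above `u` touching it at `i`; then `g v i < g u i`. -/
theorem le_of_apply_le [Finite ι] (hg : IsDiagonallyMonotone g) {u v : ι → ℝ} (h : g u ≤ g v) :
    u ≤ v := by
  intro j
  have : Nonempty ι := ⟨j⟩
  obtain ⟨i, hi⟩ := Finite.exists_max fun i => u i - v i
  refine (sub_nonpos.1 ((hi j).trans ?_))
  by_contra! hpos
  have h1 := hg.lt_add v (u i - v i) hpos i
  have h2 := hg.anti u (fun j => v j + (u i - v i)) (fun j => by linarith [hi j]) i (by ring)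
  linarith [h i]

theorem injective [Finite ι] (hg : IsDiagonallyMonotone g) : Function.Injective g :=
  fun _ _ h => le_antisymm (hg.le_of_apply_le h.le) (hg.le_of_apply_le h.ge)

/-- The flow `u' = g v - g u` is asymptotically bounded above by `v`. -/
theorem eventually_le_add [Finite ι] (hg : IsDiagonallyMonotone g) {v : ι → ℝ} {u : ℝ → ι → ℝ}
    (hu : ∀ t, 0 ≤ t → ∀ i,
      HasDerivWithinAt (fun s => u s i) (-(g (u t) i - g v i)) (Set.Ici 0) t)
    {ε : ℝ} (hε : 0 < ε) : ∀ᶠ t in Filter.atTop, ∀ i, u t i ≤ v i + ε := by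
  rcases isEmpty_or_nonempty ι with _ | _
  · exact Filter.Eventually.of_forall fun _ i => isEmptyElim i
  obtain ⟨i₀, hi₀⟩ := Finite.exists_min fun i => g (fun j => v j + ε / 2) i - g v i
  obtain ⟨i₁, hi₁⟩ := Finite.exists_max fun i => u 0 i - v i
  set δ := g (fun j => v j + ε / 2) i₀ - g v i₀ with hδ_def
  have hδ : 0 < δ := sub_pos.2 (hg.lt_add v _ (half_pos hε) i₀)
  set M := |u 0 i₁ - v i₁| + 1
  have hM : 0 < M := by positivity
  -- With this decay rate the barrier descends at speed at most `δ / 2`, while a coordinate touching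
  -- it descends faster than `δ`.
  have hc : 0 < δ / (2 * M) := by positivity
  set b : ℝ → ℝ := fun t => ε / 2 + M * Real.exp (-(δ / (2 * M)) * t)
  have hb : ∀ t, HasDerivAt b (M * (Real.exp (-(δ / (2 * M)) * t) * (-(δ / (2 * M)) * 1))) t :=
    fun t => ((((hasDerivAt_id t).const_mul _).exp).const_mul M).const_add _
  have hbε : ∀ t, ε / 2 < b t := fun t => lt_add_of_pos_right _ (by positivity)
  have hbar : ∀ t, 0 ≤ t → ∀ i, u t i - v i ≤ b t := by
    intro t ht i
    refine le_barrier (y := fun t i => u t i - v i) (fun t ht i => (hu t ht i).sub_const (v i))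
      hb (fun i => ?_) (fun t ht hle i hi => ?_) ht i
    · have : b 0 = ε / 2 + M := by simp [b]
      rw [this]
      linarith [hi₁ i, le_abs_self (u 0 i₁ - v i₁), show M = |u 0 i₁ - v i₁| + 1 from rfl]
    · have h1 := hg.anti (u t) (fun j => v j + b t) (fun j => by linarith [hle j]) i
        (by linarith)
      have h2 := hg.lt_add (fun j => v j + ε / 2) (b t - ε / 2) (sub_pos.2 (hbε t)) i
      simp only [add_assoc, add_sub_cancel] at h2
      have h3 := hi₀ i
      have h4 : Real.exp (-(δ / (2 * M)) * t) ≤ 1 :=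
        Real.exp_le_one_iff.2 (by rw [neg_mul]; exact neg_nonpos.2 (by positivity))
      have h5 : M * (Real.exp (-(δ / (2 * M)) * t) * (-(δ / (2 * M)) * 1)) =
          -(δ / 2 * Real.exp (-(δ / (2 * M)) * t)) := by
        field_simp
      rw [h5]
      nlinarith
  have hlim : Filter.Tendsto b Filter.atTop (𝓝 (ε / 2 + M * 0)) := by
    refine ((Real.tendsto_exp_atBot.comp ?_).const_mul M).const_add _
    exact Filter.tendsto_id.const_mul_atTop_of_neg (neg_lt_zero.2 hc)
  rw [mul_zero, add_zero] at hlim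
  filter_upwards [hlim.eventually_lt_const (half_lt_self hε), Filter.eventually_ge_atTop 0]
    with t h1 h2 i
  linarith [hbar t h2 i]

theorem tendsto_of_hasDerivWithinAt [Finite ι] (hg : IsDiagonallyMonotone g) {v : ι → ℝ}
    {u : ℝ → ι → ℝ} (hu : ∀ t, 0 ≤ t → ∀ i,
      HasDerivWithinAt (fun s => u s i) (-(g (u t) i - g v i)) (Set.Ici 0) t) :
    Filter.Tendsto u Filter.atTop (𝓝 v) := by
  rw [tendsto_pi_nhds]
  intro i
  rw [Metric.tendsto_nhds]
  intro ε hε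
  have h1 := hg.eventually_le_add hu (half_pos hε)
  have h2 := hg.neg_comp_neg.eventually_le_add (v := fun j => -v j) (u := fun t j => -u t j)
    (fun t ht i => by
      simp only [neg_neg]
      refine (hu t ht i).fun_neg.congr_deriv ?_
      ring) (half_pos hε)
  filter_upwards [h1, h2] with t h1 h2
  rw [Real.dist_eq, abs_lt]
  constructor <;> linarith [h1 i, h2 i]

/-- If the subsolutions above a given one are bounded above, then a solution exists. -/
theorem exists_apply_eq [Fintype ι] (hg : IsDiagonallyMonotone g) (hcont : Continuous g)
    {L a : ι → ℝ} (ha : g a ≤ L) (hbdd : BddAbove {u | a ≤ u ∧ g u ≤ L}) : ∃ u, g u = L := by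
  classical
  obtain ⟨c, hc⟩ := hbdd
  have hcomp : IsCompact {u | a ≤ u ∧ g u ≤ L} := by
    refine (isCompact_Icc (a := a) (b := c)).of_isClosed_subset ?_ fun u hu => ⟨hu.1, hc hu⟩
    exact (isClosed_le continuous_const continuous_id).inter (isClosed_le hcont continuous_const)
  -- At a maximizer no coordinate has slack: raising `u i` slightly would keep `g u i < L i` by
  -- continuity and could only lower the other components.
  obtain ⟨u, hu, hmax⟩ := hcomp.exists_isMaxOn ⟨a, le_rfl, ha⟩
    (f := fun u => ∑ i, u i) (by fun_prop)
  refine ⟨u, le_antisymm hu.2 fun i => ?_⟩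
  by_contra! hlt
  have hev : ∀ᶠ s in 𝓝[>] (0 : ℝ), g (Function.update u i (u i + s)) i < L i := by
    have hcts : Continuous fun s : ℝ => g (Function.update u i (u i + s)) i := by fun_prop
    refine (hcts.tendsto 0).mono_left nhdsWithin_le_nhds |>.eventually_lt_const ?_
    simpa using hlt
  obtain ⟨s, hs, hs0⟩ := (hev.and self_mem_nhdsWithin).exists
  have hs0 : 0 < s := hs0
  have hle : u ≤ Function.update u i (u i + s) := by
    rw [le_update_iff]
    exact ⟨by linarith, fun _ _ => le_rfl⟩
  have hmem : Function.update u i (u i + s) ∈ {u | a ≤ u ∧ g u ≤ L} := by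
    refine ⟨hu.1.trans hle, fun j => ?_⟩
    rcases eq_or_ne j i with rfl | hj
    · exact hs.le
    · exact (hg.anti u _ hle j (by simp [hj])).trans (hu.2 j)
  have hsum : ∑ j, u j < ∑ j, Function.update u i (u i + s) j :=
    Finset.sum_lt_sum (fun j _ => hle j) ⟨i, Finset.mem_univ i, by simpa using hs0⟩
  exact absurd (hmax hmem) (not_le.2 hsum)

theorem supClosed_setOf_apply_le (hg : IsDiagonallyMonotone g) (a L : ι → ℝ) :
    SupClosed {u | a ≤ u ∧ g u ≤ L} := by
  rintro u ⟨hau, hu⟩ v ⟨_, hv⟩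
  refine ⟨hau.trans le_sup_left, fun i => ?_⟩
  rcases le_total (u i) (v i) with h | h
  · exact (hg.anti v (u ⊔ v) le_sup_right i (by simp [h])).trans (hv i)
  · exact (hg.anti u (u ⊔ v) le_sup_left i (by simp [h])).trans (hu i)

end IsDiagonallyMonotone

/-- A sup-closed set of vectors is bounded above unless it contains vectors which are arbitrarily
large exactly on some nonempty set of coordinates. -/
theorem bddAbove_of_supClosed {ι : Type*} [Finite ι] {S : Set (ι → ℝ)} (hS : SupClosed S)
    (h : ∀ I : Finset ι, I.Nonempty → ∀ C : ℝ, ∃ N : ℝ, ∀ u ∈ S,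
      (∀ i ∈ I, N ≤ u i) → (∀ i ∉ I, u i ≤ C) → False) : BddAbove S := by
  classical
  have := Fintype.ofFinite ι
  set I : Finset ι := Finset.univ.filter fun i => ¬ BddAbove (Function.eval i '' S) with hI
  rcases I.eq_empty_or_nonempty with hemp | hne
  · refine bddAbove_pi.2 fun i => ?_
    by_contra hi
    have : i ∈ I := by simp [hI, hi]
    simp [hemp] at this
  exfalso
  have hC : ∃ C : ℝ, ∀ i ∉ I, ∀ u ∈ S, u i ≤ C := by
    have h1 : ∀ i, ∃ c, i ∉ I → ∀ u ∈ S, u i ≤ c := by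
      intro i
      by_cases hi : i ∈ I
      · exact ⟨0, fun h => absurd hi h⟩
      · have : BddAbove (Function.eval i '' S) := by simpa [hI] using hi
        obtain ⟨c, hc⟩ := this
        exact ⟨c, fun _ u hu => hc ⟨u, hu, rfl⟩⟩
    choose c hc using h1
    obtain ⟨C, hC⟩ := (Set.finite_range c).bddAbove
    exact ⟨C, fun i hi u hu => (hc i hi u hu).trans (hC ⟨i, rfl⟩)⟩
  obtain ⟨C, hC⟩ := hC
  obtain ⟨N, hN⟩ := h I hne C
  have h2 : ∀ i, ∃ u, i ∈ I → u ∈ S ∧ N ≤ u i := by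
    intro i
    by_cases hi : i ∈ I
    · have : ¬ BddAbove (Function.eval i '' S) := by simpa [hI] using hi
      rw [not_bddAbove_iff] at this
      obtain ⟨_, ⟨u, hu, rfl⟩, hlt⟩ := this N
      exact ⟨u, fun _ => ⟨hu, hlt.le⟩⟩
    · exact ⟨0, fun h => absurd h hi⟩
  choose u hu using h2
  -- For each unbounded coordinate a separate vector is large there; their supremum is large on all
  -- of `I` at once.
  have hmem : I.sup' hne u ∈ S := hS.finsetSup'_mem hne fun i hi => (hu i hi).1
  exact hN _ hmem (fun i hi => (hu i hi).2.trans (Finset.le_sup' u hi i))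
    (fun i hi => hC i hi _ hmem)

end CirclePattern

/-! ### The total geodesic curvature in logarithmic coordinates -/

namespace CirclePattern

namespace PolygonGluing

variable {E F : Type*} (P : PolygonGluing E F)

/-- The total geodesic curvature as a function of the logarithms of the geodesic curvatures. -/
noncomputable def logCurvature (Φ : E → ℝ) (u : F → ℝ) (f : F) : ℝ :=
  P.totalCurvature Φ (fun i => Real.exp (u i)) f

variable {Φ : E → ℝ}

theorem logCurvature_eq (hΦ : ∀ e, Φ e ∈ Set.Ioo 0 (Real.pi / 2))
    (u : F → ℝ) (f : F) : P.logCurvature Φ u f =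
    ∑ j : Fin (P.numSides f), sideCurvature (Φ (P.side.symm ⟨f, j⟩).1) (Real.exp (u f))
      (Real.exp (u (P.faceAt (P.side.symm ⟨f, j⟩).1 (!(P.side.symm ⟨f, j⟩).2)))) := by
  unfold logCurvature totalCurvature
  exact Finset.sum_congr rfl fun j _ =>
    bigonSideCurvature_eq (hΦ _) (Real.exp_pos _) (Real.exp_pos _)

/-- Regrouping polygon sides by edge brings together the two sides of one bigon, whose sum is what
the asymptotics control. -/
theorem sum_logCurvature (hΦ : ∀ e, Φ e ∈ Set.Ioo 0 (Real.pi / 2))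
    [Fintype E] [Fintype F] [DecidableEq F] (u : F → ℝ) (I : Finset F) :
    ∑ f ∈ I, P.logCurvature Φ u f = ∑ e, ∑ b, if P.faceAt e b ∈ I then
      sideCurvature (Φ e) (Real.exp (u (P.faceAt e b))) (Real.exp (u (P.faceAt e (!b))))
      else 0 := by
  let G : (f : F) × Fin (P.numSides f) → ℝ := fun x =>
    sideCurvature (Φ (P.side.symm x).1) (Real.exp (u x.1))
      (Real.exp (u (P.faceAt (P.side.symm x).1 (!(P.side.symm x).2))))
  calc ∑ f ∈ I, P.logCurvature Φ u f = ∑ f ∈ I, ∑ j, G ⟨f, j⟩ :=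
        Finset.sum_congr rfl fun f _ => P.logCurvature_eq hΦ u f
    _ = ∑ f, ∑ j, if f ∈ I then G ⟨f, j⟩ else 0 := by
        rw [← Finset.univ_inter I, ← Finset.sum_ite_mem]
        refine Finset.sum_congr rfl fun f _ => ?_
        split_ifs <;> simp_all
    _ = ∑ x : (f : F) × Fin (P.numSides f), if x.1 ∈ I then G x else 0 :=
        (Fintype.sum_sigma fun x : (f : F) × Fin (P.numSides f) =>
          if x.1 ∈ I then G x else 0).symm
    _ = ∑ h : E × Bool, if (P.side h).1 ∈ I then G (P.side h) else 0 :=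
        (P.side.sum_comp fun x => if x.1 ∈ I then G x else 0).symm
    _ = _ := by
        rw [Fintype.sum_prod_type]
        simp only [G, Equiv.symm_apply_apply]
        rfl

theorem isDiagonallyMonotone_logCurvature (hΦ : ∀ e, Φ e ∈ Set.Ioo 0 (Real.pi / 2))
    : IsDiagonallyMonotone (P.logCurvature Φ) where
  anti u v huv i hi := by
    rw [P.logCurvature_eq hΦ, P.logCurvature_eq hΦ]
    refine Finset.sum_le_sum fun j _ => ?_
    rw [hi]
    exact sideCurvature_anti (hΦ _) (Real.exp_pos _) (Real.exp_pos _)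
      (Real.exp_le_exp.2 (huv _))
  lt_add u s hs i := by
    rw [P.logCurvature_eq hΦ, P.logCurvature_eq hΦ]
    have : NeZero (P.numSides i) := ⟨(P.numSides_pos i).ne'⟩
    refine Finset.sum_lt_sum_of_nonempty Finset.univ_nonempty fun j _ => ?_
    rw [Real.exp_add, Real.exp_add, mul_comm _ (Real.exp s), mul_comm _ (Real.exp s)]
    exact sideCurvature_lt_smul (hΦ _) (Real.exp_pos _) (Real.exp_pos _) (Real.one_lt_exp_iff.2 hs)

theorem exists_lipschitzWith_logCurvature (hΦ : ∀ e, Φ e ∈ Set.Ioo 0 (Real.pi / 2)) [Fintype F] :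
    ∃ K, LipschitzWith K (P.logCurvature Φ) := by
  refine ⟨8 * ∑ f, (P.numSides f : NNReal), LipschitzWith.of_dist_le_mul fun u v => ?_⟩
  refine (dist_pi_le_iff (by positivity)).2 fun f => ?_
  rw [Real.dist_eq, P.logCurvature_eq hΦ, P.logCurvature_eq hΦ, ← Finset.sum_sub_distrib]
  have hcoord : ∀ i, |u i - v i| ≤ dist u v := fun i => dist_le_pi_dist u v i
  calc _ ≤ ∑ j : Fin (P.numSides f), 8 * dist u v := by
        refine (Finset.abs_sum_le_sum_abs _ _).trans (Finset.sum_le_sum fun j _ => ?_)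
        refine (abs_sideCurvature_exp_sub_le (hΦ _) _ _ _ _).trans ?_
        linarith [hcoord f,
          hcoord (P.faceAt (P.side.symm ⟨f, j⟩).1 (!(P.side.symm ⟨f, j⟩).2))]
    _ = 8 * (P.numSides f : ℝ) * dist u v := by simp; ring
    _ ≤ _ := by
        push_cast
        gcongr
        exact Finset.single_le_sum (f := fun f => (P.numSides f : ℝ))
          (fun _ _ => Nat.cast_nonneg _) (Finset.mem_univ f)

theorem logCurvature_nonneg (hΦ : ∀ e, Φ e ∈ Set.Ioo 0 (Real.pi / 2))
    (u : F → ℝ) (f : F) : 0 ≤ P.logCurvature Φ u f := by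
  rw [P.logCurvature_eq hΦ]
  exact Finset.sum_nonneg fun _ _ =>
    sideCurvature_nonneg (hΦ _) (Real.exp_pos _) (Real.exp_pos _)

theorem logCurvature_le (hΦ : ∀ e, Φ e ∈ Set.Ioo 0 (Real.pi / 2)) (u : F → ℝ) (f : F) :
    P.logCurvature Φ u f ≤ P.numSides f * Real.pi := by
  rw [P.logCurvature_eq hΦ]
  refine (Finset.sum_le_sum fun _ _ => sideCurvature_le_pi (Real.exp_pos _)).trans_eq ?_
  simp

theorem logCurvature_le_mul_exp (hΦ : ∀ e, Φ e ∈ Set.Ioo 0 (Real.pi / 2)) (u : F → ℝ) (f : F) :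
    P.logCurvature Φ u f ≤ P.numSides f * (Real.pi * Real.exp (u f)) := by
  rw [P.logCurvature_eq hΦ]
  refine (Finset.sum_le_sum fun _ _ => sideCurvature_le_pi_mul (Real.exp_pos _)).trans_eq ?_
  simp

/-- If the curvatures of the faces in `I` are large and the others bounded, the total geodesic
curvature of `I` almost attains its upper bound. -/
theorem le_sum_logCurvature (hΦ : ∀ e, Φ e ∈ Set.Ioo 0 (Real.pi / 2))
    [Fintype E] [Fintype F] {u : F → ℝ} {I : Finset F} {C N : ℝ}
    (hC : 0 ≤ C) (hN : 1 ≤ N) (hI : ∀ i ∈ I, N ≤ Real.exp (u i))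
    (hI' : ∀ i ∉ I, Real.exp (u i) ≤ C) :
    2 * ∑ e ∈ P.edgesOf I, Φ e - Fintype.card E * ((Real.pi + 2 * C) / N) ≤
      ∑ f ∈ I, P.logCurvature Φ u f := by
  classical
  have hε : 0 ≤ (Real.pi + 2 * C) / N := by have := Real.pi_pos; positivity
  have hmono : Real.pi / N ≤ (Real.pi + 2 * C) / N := by gcongr; linarith
  have hmem : ∀ e, e ∈ P.edgesOf I ↔ P.faceAt e false ∈ I ∨ P.faceAt e true ∈ I := by
    intro e
    simp [edgesOf]
  rw [P.sum_logCurvature hΦ, show P.edgesOf I = Finset.univ.filter (· ∈ P.edgesOf I) by simp,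
    Finset.sum_filter, Finset.mul_sum, ← nsmul_eq_mul, ← Finset.card_univ, ← Finset.sum_const,
    ← Finset.sum_sub_distrib]
  refine Finset.sum_le_sum fun e _ => ?_
  simp only [Fintype.sum_bool, hmem, Bool.not_true, Bool.not_false]
  -- An edge whose two sides lie on the same face falls under the first or the last case.
  by_cases h0 : P.faceAt e false ∈ I <;> by_cases h1 : P.faceAt e true ∈ I <;>
    simp only [h0, h1, if_true, if_false, true_or, or_true, or_self]
  · linarith [sideCurvature_add_ge (hΦ e) hN (hI _ h0) (hI _ h1)]
  · linarith [sideCurvature_ge (hΦ e) hN (hI _ h0) (Real.exp_pos _) (hI' _ h1)]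
  · linarith [sideCurvature_ge (hΦ e) hN (hI _ h1) (Real.exp_pos _) (hI' _ h0)]
  · linarith

theorem bddAbove_logCurvature_le (hΦ : ∀ e, Φ e ∈ Set.Ioo 0 (Real.pi / 2))
    [Fintype E] [Fintype F] {L : F → ℝ} (hL : L ∈ P.admissible Φ)
    (a : F → ℝ) : BddAbove {u | a ≤ u ∧ P.logCurvature Φ u ≤ L} := by
  refine bddAbove_of_supClosed
    ((P.isDiagonallyMonotone_logCurvature hΦ).supClosed_setOf_apply_le a L) fun I hI C => ?_
  have hgap := sub_pos.2 (hL.2 I hI)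
  set d := 2 * ∑ e ∈ P.edgesOf I, Φ e - ∑ f ∈ I, L f
  set A := Fintype.card E * (Real.pi + 2 * Real.exp C)
  have hA : 0 ≤ A := by have := Real.pi_pos; positivity
  -- Chosen so that `d * N = A + d > A`, against the bound `d ≤ A / N`.
  set N := A / d + 1
  have hN : 1 ≤ N := by simp only [N]; linarith [div_nonneg hA hgap.le]
  refine ⟨Real.log N, fun u hu h1 h2 => ?_⟩
  have h := P.le_sum_logCurvature hΦ (Real.exp_pos C).le hN
    (fun i hi => (Real.log_le_iff_le_exp (by linarith)).1 (h1 i hi))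
    (fun i hi => Real.exp_le_exp.2 (h2 i hi))
  have h3 : ∑ f ∈ I, P.logCurvature Φ u f ≤ ∑ f ∈ I, L f :=
    Finset.sum_le_sum fun f _ => hu.2 f
  have h4 : d ≤ A / N := by
    simp only [A, d, mul_div_assoc]
    linarith
  rw [le_div_iff₀ (by linarith)] at h4
  have h5 : d * N = A + d := by
    simp only [N]
    field_simp
  linarith

theorem exists_logCurvature_eq (hΦ : ∀ e, Φ e ∈ Set.Ioo 0 (Real.pi / 2))
    [Fintype E] [Fintype F] {L : F → ℝ} (hL : L ∈ P.admissible Φ) :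
    ∃ u, P.logCurvature Φ u = L := by
  have hn : ∀ f, 0 < (P.numSides f : ℝ) * Real.pi := fun f =>
    mul_pos (Nat.cast_pos.2 (P.numSides_pos f)) Real.pi_pos
  obtain ⟨K, hK⟩ := P.exists_lipschitzWith_logCurvature hΦ
  refine (P.isDiagonallyMonotone_logCurvature hΦ).exists_apply_eq hK.continuous
    -- A subsolution, since the curvature of `f` is at most `numSides f * π * exp (u f)`; positivity
    -- of `L` is needed for the logarithm.
    (a := fun f => Real.log (L f / (P.numSides f * Real.pi))) (fun f => ?_)
    (P.bddAbove_logCurvature_le hΦ hL _)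
  refine (P.logCurvature_le_mul_exp hΦ _ f).trans_eq ?_
  rw [Real.exp_log (div_pos (hL.1 f) (hn f)), ← mul_assoc, mul_div_cancel₀ _ (hn f).ne']

theorem totalCurvature_eq_logCurvature {k : F → ℝ} (hk : ∀ f, 0 < k f) :
    P.totalCurvature Φ k = P.logCurvature Φ fun f => Real.log (k f) := by
  funext f
  rw [logCurvature]
  simp only [Real.exp_log (hk _)]

theorem IsFlowOn.hasDerivWithinAt_log [Fintype F] {L k₀ : F → ℝ} {I : Set ℝ} {k : ℝ → F → ℝ}
    (hk : P.IsFlowOn Φ L k₀ I k) {t : ℝ} (ht : t ∈ I) :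
    HasDerivWithinAt (fun s f => Real.log (k s f))
      (-(P.logCurvature Φ (fun f => Real.log (k t f)) - L)) I t := by
  refine hasDerivWithinAt_pi.2 fun f => ?_
  obtain ⟨hpos, hd⟩ := hk.2 t ht f
  refine (hd.log hpos.ne').congr_deriv ?_
  rw [P.totalCurvature_eq_logCurvature fun f => (hk.2 t ht f).1, mul_div_cancel_right₀ _ hpos.ne']
  rfl

theorem isFlowOn_exp {L k₀ : F → ℝ} {I : Set ℝ} {u : ℝ → F → ℝ}
    (h0 : ∀ f, Real.exp (u 0 f) = k₀ f) (hu : ∀ t ∈ I, ∀ f,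
      HasDerivWithinAt (fun s => u s f) (-(P.logCurvature Φ (u t) f - L f)) I t) :
    P.IsFlowOn Φ L k₀ I fun t f => Real.exp (u t f) := by
  refine ⟨funext h0, fun t ht f => ⟨Real.exp_pos _, ?_⟩⟩
  refine (hu t ht f).exp.congr_deriv ?_
  rw [mul_comm]
  rfl

theorem exists_norm_logCurvature_le (hΦ : ∀ e, Φ e ∈ Set.Ioo 0 (Real.pi / 2))
    [Fintype F] (L : F → ℝ) :
    ∃ B : NNReal, ∀ u, ‖-(P.logCurvature Φ u - L)‖ ≤ B := by
  refine ⟨(∑ f, (P.numSides f * Real.pi + |L f|)).toNNReal, fun u => ?_⟩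
  have hnn : ∀ f, 0 ≤ P.numSides f * Real.pi + |L f| := fun f => by
    have := Real.pi_pos
    positivity
  rw [norm_neg, Real.coe_toNNReal _ (Finset.sum_nonneg fun f _ => hnn f)]
  refine (pi_norm_le_iff_of_nonneg (Finset.sum_nonneg fun f _ => hnn f)).2 fun f => ?_
  refine le_trans ?_ (Finset.single_le_sum (fun f _ => hnn f) (Finset.mem_univ f))
  refine (norm_sub_le _ _).trans (add_le_add ?_ le_rfl)
  rw [Real.norm_of_nonneg (P.logCurvature_nonneg hΦ u f)]
  exact P.logCurvature_le hΦ u f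

end PolygonGluing

end CirclePattern

/-! ### Existence, uniqueness and convergence of the flow -/

theorem theorem1p7 {E F S : Type*} [Fintype E] [Fintype F] [TopologicalSpace S]
    (D : CirclePattern.CellularDecomposition E F S)
    (Φ : E → ℝ) (hΦ : ∀ e, Φ e ∈ Set.Ioo 0 (Real.pi / 2))
    (Lhat : F → ℝ) (hL : Lhat ∈ D.admissible Φ) :
    ∃ khat : F → ℝ,
      D.HasTotalCurvature Φ Lhat khat ∧
      (∀ k : F → ℝ, D.HasTotalCurvature Φ Lhat k → k = khat) ∧
      ∀ k₀ : F → ℝ, (∀ f, 0 < k₀ f) →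
        ∃ k : ℝ → F → ℝ,
          D.IsFlowOn Φ Lhat k₀ (Set.Ici 0) k ∧
          (∀ T : ℝ, 0 < T → ∀ k' : ℝ → F → ℝ,
            D.IsFlowOn Φ Lhat k₀ (Set.Ico 0 T) k' → Set.EqOn k' k (Set.Ico 0 T)) ∧
          Filter.Tendsto k Filter.atTop (𝓝 khat) := by
  have hmono := D.isDiagonallyMonotone_logCurvature hΦ
  obtain ⟨K, hK⟩ := D.exists_lipschitzWith_logCurvature hΦ
  obtain ⟨v, hv⟩ := D.exists_logCurvature_eq hΦ hL
  refine ⟨fun f => Real.exp (v f), ⟨fun f => Real.exp_pos _, fun f => congrFun hv f⟩, ?_, ?_⟩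
  · rintro k ⟨hk, hkL⟩
    have : (fun f => Real.log (k f)) = v := hmono.injective <| by
      rw [← D.totalCurvature_eq_logCurvature hk, hv]
      exact funext hkL
    funext f
    rw [← this, Real.exp_log (hk f)]
  intro k₀ hk₀
  obtain ⟨B, hB⟩ := D.exists_norm_logCurvature_le hΦ Lhat
  have hlip : LipschitzWith K fun u => -(D.logCurvature Φ u - Lhat) :=
    LipschitzWith.of_dist_le_mul fun u w => by
      rw [dist_neg_neg, dist_sub_right]
      exact hK.dist_le_mul u w
  obtain ⟨u, hu0, hu⟩ := hlip.exists_hasDerivWithinAt_Ici hB fun f => Real.log (k₀ f)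
  refine ⟨fun t f => Real.exp (u t f), ?_, fun T hT k' hk' => ?_, ?_⟩
  · exact D.isFlowOn_exp (fun f => by rw [hu0, Real.exp_log (hk₀ f)])
      fun t ht => hasDerivWithinAt_pi.1 (hu t ht)
  · have heq := hlip.eqOn_Ico_of_hasDerivWithinAt
      (fun t ht => hk'.hasDerivWithinAt_log D.toPolygonGluing ht)
      (fun t ht => (hu t ht.1).mono fun s hs => hs.1) (by rw [hu0, hk'.1])
    intro t ht
    funext f
    change _ = Real.exp (u t f)
    rw [← heq ht, Real.exp_log (hk'.2 t ht f).1]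
  · rw [← hv] at hu
    have hlim := hmono.tendsto_of_hasDerivWithinAt fun t ht => hasDerivWithinAt_pi.1 (hu t ht)
    exact tendsto_pi_nhds.2 fun f => (tendsto_pi_nhds.1 hlim f).rexp
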